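/- Let $K$ be a field, $R=K[x_1,\dots,x_n]$, and let $I\subseteq R$ be a monomial ideal with minimal set of monomial generators $G(I)$. Fix a total order $\prec$ on $G(I)$ and write $G(I)=\{m_1\prec\cdots\prec m_\mu\}$. A symbol $u(i_1;\dots;i_t)$ with $1\le i_1<\cdots<i_t\le\mu$ is called $L$-admissible of dimension $t$ if $m_q\nmid \mathrm{lcm}(m_{i_h},m_{i_{h+1}},\dots,m_{i_t})$ for all $h<t$ and all $q<i_h$. The Lyubeznik resolution of $R/I$ with respect to $\prec$ is the complex $0\to L^\mu\to\cdots\to L^1\to L^0=R\to R/I\to 0$, where $L^t$ is the free $R$-module on the $L$-admissible symbols of dimension $t$ and $$\partial_t\,u(i_1;\dots;i_t)=\sum_{j=1}^t(-1)^{j+1}\frac{\mathrm{lcm}(m_{i_1},\dots,m_{i_t})}{\mathrm{lcm}(m_{i_1},\dots,\widehat{m_{i_j}},\dots,m_{i_t})}\,u(i_1;\dots;\widehat{i_j};\dots;i_t).$$ Let $L_\prec(I)$ be its length, i.e. the largest $t$ with $L^t\neq 0$, and let $L(I)=\min_\prec L_\prec(I)$ over all total orders $\prec$ on $G(I)$.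 The ideal $I$ is a Lyubeznik ideal if for some total order $\prec$ the Lyubeznik resolution is a minimal free resolution of $R/I$ (minimal means $\partial_t(L^t)\subseteq(x_1,\dots,x_n)L^{t-1}$ for all $t\ge 1$), and an almost Lyubeznik ideal if $L(I)=\mathrm{projdim}(R/I)$, the projective dimension over $R$ (with $\mathrm{projdim}(0)=-\infty$). A nonempty subset $D\subseteq G(I)$ is broken (with respect to $\prec$) if some $u\in G(I)$ with $u\prec\min(D)$ divides $\mathrm{lcm}(D)$; a subset of $G(I)$ is preserved if none of its subsets is broken. Let $ps(I,\prec)$ be the maximal cardinality of a preserved subset of $G(I)$, and $ps(I)=\min_\prec ps(I,\prec)$ over all total orders $\prec$ on $G(I)$. Then: 1. If $I$ is a Lyubeznik ideal or an almost Lyubeznik ideal, then $\mathrm{projdim}(R/I)=L(I)=ps(I)$. 2. Conversely, if $\mathrm{projdim}(R/I)=ps(I)$, then $I$ is an almost Lyubeznik ideal. -/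

import Mathlib

namespace Lyubeznik

open MvPolynomial CategoryTheory

universe u v

noncomputable section

/-! A monomial `x^a` is represented by its exponent vector `a : Fin n →₀ ℕ`; divisibility of
monomials is then `≤`, and the least common multiple is the supremum. -/

section Symbols

variable {n : ℕ} {ι : Type v} [LinearOrder ι] (m : ι → (Fin n →₀ ℕ))

/-- The least common multiple of the monomials `m i`, `i ∈ A` (it is `1` for `A = ∅`). -/
def lcm (A : Finset ι) : Fin n →₀ ℕ := A.sup m

/-- The symbol `u(i₁; …; iₜ)`, `A = {i₁ < ⋯ < iₜ}`, is `L`-admissible: for every `h < t` and every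
`q < i_h`, the monomial `m_q` does not divide `lcm(m_{i_h}, …, m_{i_t})`. -/
def IsAdmissible (A : Finset ι) : Prop :=
  ∀ i ∈ A, (∃ j ∈ A, i < j) → ∀ q < i, ¬ m q ≤ lcm m (A.filter (fun k => i ≤ k))

theorem IsAdmissible.erase {A : Finset ι} (hA : IsAdmissible m A) (k : ι) :
    IsAdmissible m (A.erase k) := by
  intro i hi hj q hq hle
  obtain ⟨j, hjA, hij⟩ := hj
  refine hA i (Finset.mem_of_mem_erase hi) ⟨j, Finset.mem_of_mem_erase hjA, hij⟩ q hq
    (hle.trans ?_)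
  exact Finset.sup_mono (Finset.filter_subset_filter _ (Finset.erase_subset k A))

/-- The `L`-admissible symbols of dimension `t`. -/
def Sym (t : ℕ) : Type v := {A : Finset ι // IsAdmissible m A ∧ A.card = t}

variable {m} in
/-- The symbol obtained from `A` by omitting the entry `i`. -/
def Sym.face {t : ℕ} (A : Sym m (t + 1)) (i : {i // i ∈ A.1}) : Sym m t :=
  ⟨A.1.erase i.1, A.2.1.erase m i.1, by
    rw [Finset.card_erase_of_mem i.2, A.2.2, Nat.add_sub_cancel]⟩

/-- `L^t`: the free `R`-module on the `L`-admissible symbols of dimension `t`. The only symbol of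
dimension `0` is the empty one, so `L^0` is `R`. -/
abbrev Chain (K : Type u) [Field K] (t : ℕ) : Type (max v u) := Sym m t →₀ MvPolynomial (Fin n) K

/-- The differential `∂_{t+1} : L^{t+1} → L^t`,
`u(A) ↦ ∑_{i ∈ A} ± (lcm(A) / lcm(A ∖ {i})) u(A ∖ {i})`; the sign `(-1)^(j+1)` of the `j`-th element
`i` of `A` is `(-1)` to the number of elements of `A` below `i`. -/
def diff (K : Type u) [Field K] (t : ℕ) :
    Chain m K (t + 1) →ₗ[MvPolynomial (Fin n) K] Chain m K t :=
  Finsupp.linearCombination (MvPolynomial (Fin n) K) fun A : Sym m (t + 1) =>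
    ∑ i ∈ A.1.attach, Finsupp.single (A.face i)
      ((-1) ^ (A.1.filter (fun k => k < i.1)).card *
        monomial (lcm m A.1 - lcm m (A.1.erase i.1)) (1 : K))

/-- The augmentation `∂₀ : L^0 = R → R / I`. -/
def augmentation (K : Type u) [Field K] (I : Ideal (MvPolynomial (Fin n) K)) :
    Chain m K 0 →ₗ[MvPolynomial (Fin n) K] (MvPolynomial (Fin n) K ⧸ I) :=
  Finsupp.linearCombination (MvPolynomial (Fin n) K) fun _ : Sym m 0 => Ideal.Quotient.mk I 1

/-- The complex `⋯ → L^2 → L^1 → L^0 → R / I → 0` is exact. -/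
def IsResolution (K : Type u) [Field K] (I : Ideal (MvPolynomial (Fin n) K)) : Prop :=
  Function.Surjective (augmentation m K I) ∧
  Function.Exact (diff m K 0) (augmentation m K I) ∧
  ∀ t, Function.Exact (diff m K (t + 1)) (diff m K t)

/-- Minimality: `∂(L^{t+1}) ⊆ 𝔪 L^t` for all `t`, where `𝔪 = (x₁, …, xₙ)`. -/
def IsMinimal (K : Type u) [Field K] : Prop :=
  ∀ t, LinearMap.range (diff m K t) ≤
    Ideal.span (Set.range (X : Fin n → MvPolynomial (Fin n) K)) •
      (⊤ : Submodule (MvPolynomial (Fin n) K) (Chain m K t))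

/-- The length of the complex: the largest `t` with `L^t ≠ 0`. -/
def length (K : Type u) [Field K] : ℕ := sSup {t | Nontrivial (Chain m K t)}

/-- `D` is broken: some monomial `m u` divides `lcm(D)` while `u` lies strictly below `min(D)`.
Here `D` has to be nonempty for `min(D)` to exist. -/
def IsBroken (D : Finset ι) : Prop :=
  D.Nonempty ∧ ∃ u, m u ≤ lcm m D ∧ ∀ v ∈ D, u < v

/-- `E` is preserved: no subset of `E` is broken. -/
def IsPreserved (E : Finset ι) : Prop := ∀ D ⊆ E, ¬ IsBroken m D

/-- The largest size of a preserved set. -/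
def preservedSize : ℕ := sSup {k | ∃ A : Finset ι, IsPreserved m A ∧ A.card = k}

end Symbols

section Ideals

variable {K : Type u} [Field K] {n : ℕ} (I : Ideal (MvPolynomial (Fin n) K))

/-- `I` is generated by monomials. -/
def IsMonomialIdeal : Prop :=
  ∃ S : Set (Fin n →₀ ℕ), I = Ideal.span ((fun a => monomial a (1 : K)) '' S)

/-- The minimal monomial generating set `G(I)`: the monomials of `I` that are minimal with respect
to divisibility. It is a type of its own, so that it carries no order beforehand. -/
def G : Type := {a : Fin n →₀ ℕ // Minimal (fun b => monomial b (1 : K) ∈ I) a}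

/-- The monomial underlying an element of `G(I)`. -/
def G.mon (g : G I) : Fin n →₀ ℕ := g.1

/-- The length `L_≺(I)` of the Lyubeznik resolution of `R / I` for the total order `≺` on `G(I)`. -/
def orderedLLength (ord : LinearOrder (G I)) : ℕ := length (G.mon I) K

/-- `L(I)`: the minimum of `L_≺(I)` over all total orders `≺` on `G(I)`. -/
def LLength : ℕ := sInf {k | ∃ ord : LinearOrder (G I), orderedLLength I ord = k}

/-- The preserved size `ps(I, ≺)` for the total order `≺` on `G(I)`. -/
def orderedPs (ord : LinearOrder (G I)) : ℕ := preservedSize (G.mon I)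

/-- `ps(I)`: the minimum of `ps(I, ≺)` over all total orders `≺` on `G(I)`. -/
def ps : ℕ := sInf {k | ∃ ord : LinearOrder (G I), orderedPs I ord = k}

/-- The projective dimension of `R / I` over `R`; it is `⊥` when `R / I = 0`. -/
def projdim : WithBot ℕ∞ :=
  projectiveDimension (ModuleCat.of (MvPolynomial (Fin n) K) (MvPolynomial (Fin n) K ⧸ I))

/-- `I` is a Lyubeznik ideal: for some total order on `G(I)` the corresponding Lyubeznik resolution
is a minimal free resolution of `R / I`. -/
def IsLyubeznikIdeal : Prop :=
  ∃ _ord : LinearOrder (G I), IsResolution (G.mon I) K I ∧ IsMinimal (G.mon I) K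

/-- `I` is an almost Lyubeznik ideal: `L(I) = projdim(R / I)`. -/
def IsAlmostLyubeznikIdeal : Prop := (LLength I : WithBot ℕ∞) = projdim I

end Ideals

end

end Lyubeznik

namespace Lyubeznik

open MvPolynomial CategoryTheory

universe u v

/-! ### Projective dimension bounds from resolutions -/

section Homological

universe w

variable {R : Type w} [CommRing R]

/-! Two facts carry the proof. Combinatorially, admissible symbols and preserved sets coincide
(`isAdmissible_iff_isPreserved`): a broken subset forces the failing tail at its minimum, and a
failing tail is itself broken. Hence `L_≺(I) = ps(I, ≺)` for every order, and `L(I) = ps(I)`.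

Homologically, the Lyubeznik complex is a free resolution for every order (`isResolution`). It
splits over `K` into multidegrees `a`, and each strand in which some generator divides `x^a` is
contracted by coning with the least such generator. So `projdim ≤ L(I)`. If the resolution for some
order is minimal, its length `L_≺(I) ≥ L(I)` is also a lower bound for `projdim`. The almost
Lyubeznik case and the converse are then formal. -/

/-- A coordinate functional sends `J • ⊤` into `J` but takes the value `1` on its basis vector. This
replaces Nakayama, so no local or graded structure is needed. -/
theorem Free.smul_top_ne_top {M : Type w} [AddCommGroup M] [Module R M] [Module.Free R M]
    [Nontrivial M] {J : Ideal R} (hJ : J ≠ ⊤) : J • (⊤ : Submodule R M) ≠ ⊤ := by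
  intro h
  let b := Module.Free.chooseBasis R M
  obtain ⟨i⟩ := b.index_nonempty
  refine hJ ((Ideal.eq_top_iff_one J).2 ?_)
  have hle : J • (⊤ : Submodule R M) ≤ Submodule.comap (b.coord i) J :=
    Submodule.smul_le.2 fun r hr x _ => by
      simpa using J.mul_mem_right _ hr
  have := hle ((Submodule.eq_top_iff'.1 h) (b i))
  simpa using this

/-- The map `F (t + 1) → F t` of a complex, restricted to the kernel of the augmentation. -/
def toKer {M F₀ F₁ : Type w} [AddCommGroup M] [Module R M] [AddCommGroup F₀] [Module R F₀]
    [AddCommGroup F₁] [Module R F₁] {d : F₁ →ₗ[R] F₀} {ε : F₀ →ₗ[R] M}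
    (h : Function.Exact d ε) : F₁ →ₗ[R] LinearMap.ker ε :=
  d.codRestrict _ fun x => h.apply_apply_eq_zero x

theorem toKer_surjective {M F₀ F₁ : Type w} [AddCommGroup M] [Module R M] [AddCommGroup F₀]
    [Module R F₀] [AddCommGroup F₁] [Module R F₁] {d : F₁ →ₗ[R] F₀} {ε : F₀ →ₗ[R] M}
    (h : Function.Exact d ε) : Function.Surjective (toKer h) := by
  rintro ⟨y, hy⟩
  obtain ⟨x, rfl⟩ := (h y).1 hy
  exact ⟨x, rfl⟩

theorem exact_toKer {M F₀ F₁ F₂ : Type w} [AddCommGroup M] [Module R M] [AddCommGroup F₀]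
    [Module R F₀] [AddCommGroup F₁] [Module R F₁] [AddCommGroup F₂] [Module R F₂]
    {d' : F₂ →ₗ[R] F₁} {d : F₁ →ₗ[R] F₀} {ε : F₀ →ₗ[R] M} (h : Function.Exact d ε)
    (h' : Function.Exact d' d) : Function.Exact d' (toKer h) := fun x =>
  (Subtype.ext_iff (a1 := toKer h x) (a2 := 0)).trans (h' x)

theorem hasProjectiveDimensionLT_iff_ker {M F₀ : Type w} [AddCommGroup M] [Module R M]
    [AddCommGroup F₀] [Module R F₀] [Module.Projective R F₀] {ε : F₀ →ₗ[R] M}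
    (hε : Function.Surjective ε) (k : ℕ) :
    HasProjectiveDimensionLT (ModuleCat.of R M) (k + 2) ↔
      HasProjectiveDimensionLT (ModuleCat.of R (LinearMap.ker ε)) (k + 1) :=
  (LinearMap.shortExact_shortComplexKer hε).hasProjectiveDimensionLT_X₃_iff k
    ((IsProjective.iff_projective F₀).1 inferInstance)

theorem hasProjectiveDimensionLT_one_iff {M : Type w} [AddCommGroup M] [Module R M] :
    HasProjectiveDimensionLT (ModuleCat.of R M) 1 ↔ Module.Projective R M := by
  rw [← projective_iff_hasProjectiveDimensionLT_one, ← IsProjective.iff_projective]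

/-- A projective resolution that vanishes in degree `ℓ + 1` bounds the projective dimension
by `ℓ`. -/
theorem hasProjectiveDimensionLT_of_resolution (ℓ : ℕ) {M : Type w} [AddCommGroup M] [Module R M]
    (F : ℕ → Type w) [∀ t, AddCommGroup (F t)] [∀ t, Module R (F t)]
    [∀ t, Module.Projective R (F t)] (d : ∀ t, F (t + 1) →ₗ[R] F t) (ε : F 0 →ₗ[R] M)
    (hε : Function.Surjective ε) (h₀ : Function.Exact (d 0) ε)
    (hd : ∀ t, Function.Exact (d (t + 1)) (d t)) [hℓ : Subsingleton (F (ℓ + 1))] :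
    HasProjectiveDimensionLT (ModuleCat.of R M) (ℓ + 1) := by
  induction ℓ generalizing M F with
  | zero =>
    rw [zero_add, hasProjectiveDimensionLT_one_iff]
    have : Function.Injective ε := (injective_iff_map_eq_zero ε).2 fun x hx => by
      obtain ⟨y, rfl⟩ := (h₀ x).1 hx
      rw [Subsingleton.elim y 0, map_zero]
    exact Module.Projective.of_equiv (LinearEquiv.ofBijective ε ⟨this, hε⟩)
  | succ ℓ ih =>
    rw [hasProjectiveDimensionLT_iff_ker hε]
    -- Dimension shifting: the truncated complex resolves the first syzygy `ker ε`.
    exact ih (fun t => F (t + 1)) (fun t => d (t + 1)) (toKer h₀) (toKer_surjective h₀)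
      (exact_toKer h₀ (hd 0)) (fun t => hd (t + 1))

/-- A minimal free resolution of length `ℓ` is a lower bound for the projective dimension. -/
theorem not_hasProjectiveDimensionLT_of_minimal (ℓ : ℕ) {J : Ideal R} (hJ : J ≠ ⊤)
    {M : Type w} [AddCommGroup M] [Module R M]
    (F : ℕ → Type w) [∀ t, AddCommGroup (F t)] [∀ t, Module R (F t)]
    [∀ t, Module.Free R (F t)] (d : ∀ t, F (t + 1) →ₗ[R] F t) (ε : F 0 →ₗ[R] M)
    (hε : Function.Surjective ε) (h₀ : Function.Exact (d 0) ε)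
    (hd : ∀ t, Function.Exact (d (t + 1)) (d t))
    (hmin : ∀ t, LinearMap.range (d t) ≤ J • (⊤ : Submodule R (F t)))
    [hℓ : Subsingleton (F (ℓ + 1))] [hn : Nontrivial (F ℓ)] :
    ¬ HasProjectiveDimensionLT (ModuleCat.of R M) ℓ := by
  induction ℓ generalizing M F with
  | zero =>
    rw [hasProjectiveDimensionLT_zero_iff_isZero, ModuleCat.isZero_iff_subsingleton]
    intro (hM : Subsingleton M)
    obtain ⟨x, hx⟩ := exists_ne (0 : F 0)
    obtain ⟨y, rfl⟩ := (h₀ x).1 (Subsingleton.elim _ _)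
    exact hx (by rw [Subsingleton.elim y 0, map_zero])
  | succ ℓ ih =>
    cases ℓ with
    -- Shifting only relates the bounds `k + 2` and `k + 1`, so `ℓ = 1` is a base case of its own.
    -- If `M` were projective, `0 → F 1 → F 0 → M → 0` would split; the retraction carries the range
    -- of `d 0`, which lies in `J • F 0`, onto `F 1`, giving `F 1 = J • F 1`.
    | zero =>
      rw [zero_add, hasProjectiveDimensionLT_one_iff]
      intro hM
      obtain ⟨s, hs⟩ := ε.exists_rightInverse_of_surjective (LinearMap.range_eq_top.2 hε)
      have hinj : Function.Injective (d 0) := (injective_iff_map_eq_zero (d 0)).2 fun x hx => by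
        obtain ⟨y, rfl⟩ := (hd 0 x).1 hx
        rw [Subsingleton.elim y 0, map_zero]
      obtain ⟨r, hr⟩ : ∃ r : F 0 →ₗ[R] F 1, r ∘ₗ d 0 = LinearMap.id :=
        ((Function.Exact.split_tfae' h₀).out 0 1 rfl rfl).1 ⟨hinj, s, hs⟩ |>.2
      refine Free.smul_top_ne_top (M := F 1) hJ (top_le_iff.1 ?_)
      calc (⊤ : Submodule R (F 1)) = (LinearMap.range (d 0)).map r := by
            rw [← LinearMap.range_comp, hr, LinearMap.range_id]
        _ ≤ (J • (⊤ : Submodule R (F 0))).map r := Submodule.map_mono (hmin 0)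
        _ ≤ J • ⊤ := by
            rw [Submodule.map_smul'']
            exact Submodule.smul_mono le_rfl le_top
    | succ ℓ =>
      rw [hasProjectiveDimensionLT_iff_ker hε]
      exact ih (fun t => F (t + 1)) (fun t => d (t + 1)) (toKer h₀) (toKer_surjective h₀)
        (exact_toKer h₀ (hd 0)) (fun t => hd (t + 1)) (fun t => hmin (t + 1))

end Homological

/-! ### Admissible symbols versus preserved sets -/

section Combinatorics

variable {n : ℕ} {ι : Type v} {m : ι → (Fin n →₀ ℕ)}

theorem le_lcm {A : Finset ι} {i : ι} (hi : i ∈ A) : m i ≤ lcm m A := Finset.le_sup hi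

theorem lcm_mono {A B : Finset ι} (h : A ⊆ B) : lcm m A ≤ lcm m B := Finset.sup_mono h

variable [LinearOrder ι]

theorem lcm_insert (q : ι) (A : Finset ι) : lcm m (insert q A) = m q ⊔ lcm m A :=
  Finset.sup_insert

/-- For a set of minimal generators, admissible symbols and preserved sets are the same. -/
theorem isAdmissible_iff_isPreserved (hm : ∀ i j, m i ≤ m j → i = j) (A : Finset ι) :
    IsAdmissible m A ↔ IsPreserved m A := by
  constructor
  · rintro hA D hD ⟨hne, u, hu, hlt⟩
    have hmin := D.min'_mem hne
    by_cases h : ∃ j ∈ A, D.min' hne < j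
    · refine hA _ (hD hmin) h u (hlt _ hmin) (hu.trans (lcm_mono fun k hk => ?_))
      exact Finset.mem_filter.2 ⟨hD hk, D.min'_le k hk⟩
    -- Admissibility imposes nothing at the largest entry of `A`; here `D` is that single entry, and
    -- the antichain hypothesis takes over.
    · have hD' : D = {D.min' hne} := Finset.eq_singleton_iff_unique_mem.2
        ⟨hmin, fun k hk => le_antisymm (not_lt.1 fun hlt => h ⟨k, hD hk, hlt⟩) (D.min'_le k hk)⟩
      have hu' : m u ≤ m (D.min' hne) := by
        rw [hD', lcm, Finset.sup_singleton] at hu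
        exact hu
      exact (hlt _ hmin).ne (hm _ _ hu')
  · intro hA i hi _ q hq hle
    refine hA _ (Finset.filter_subset (fun k => i ≤ k) A)
      ⟨⟨i, Finset.mem_filter.2 ⟨hi, le_rfl⟩⟩, q, hle, fun k hk => ?_⟩
    exact hq.trans_le (Finset.mem_filter.1 hk).2

theorem nontrivial_chain_iff (K : Type u) [Field K] (t : ℕ) :
    Nontrivial (Chain m K t) ↔ ∃ A : Finset ι, IsAdmissible m A ∧ A.card = t := by
  rw [← nonempty_subtype]
  constructor
  · intro h
    by_contra hne
    have : IsEmpty (Sym m t) := not_nonempty_iff.1 hne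
    exact not_subsingleton (Chain m K t) inferInstance
  · intro h
    have : Nonempty (Sym m t) := h
    infer_instance

theorem length_eq_preservedSize (K : Type u) [Field K] (hm : ∀ i j, m i ≤ m j → i = j) :
    length m K = preservedSize m := by
  simp only [length, preservedSize, nontrivial_chain_iff, isAdmissible_iff_isPreserved hm]

variable (m) in
theorem bddAbove_nontrivial_chain [Finite ι] (K : Type u) [Field K] :
    BddAbove {t | Nontrivial (Chain m K t)} := by
  have := Fintype.ofFinite ι
  refine ⟨Fintype.card ι, fun t ht => ?_⟩
  obtain ⟨A, -, rfl⟩ := (nontrivial_chain_iff K t).1 ht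
  exact A.card_le_univ

variable (m) in
theorem nontrivial_chain_length [Finite ι] (K : Type u) [Field K] :
    Nontrivial (Chain m K (length m K)) := by
  refine Nat.sSup_mem (s := {t | Nontrivial (Chain m K t)}) ⟨0, ?_⟩
    (bddAbove_nontrivial_chain m K)
  exact (nontrivial_chain_iff K 0).2 ⟨∅, fun i hi => absurd hi (Finset.notMem_empty i), rfl⟩

variable (m) in
theorem subsingleton_chain_length_succ [Finite ι] (K : Type u) [Field K] :
    Subsingleton (Chain m K (length m K + 1)) := by
  rw [← not_nontrivial_iff_subsingleton]
  intro h
  exact (Nat.lt_succ_self _).not_ge (le_csSup (bddAbove_nontrivial_chain m K) h)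

/-- Adding the least generator that divides `x^a` to a symbol of lcm dividing `x^a` keeps it
admissible. -/
theorem IsAdmissible.insert {A : Finset ι} (hA : IsAdmissible m A) {a : Fin n →₀ ℕ}
    (hAa : lcm m A ≤ a) {q : ι} (hq : IsLeast {i | m i ≤ a} q) :
    IsAdmissible m (insert q A) := by
  have hqA : ∀ i ∈ A, q ≤ i := fun i hi => hq.2 ((le_lcm hi).trans hAa)
  intro i hi hj p hp hle
  obtain ⟨j, hjA, hij⟩ := hj
  rcases (Finset.mem_insert.1 hi) with rfl | hiA
  -- A generator dividing the enlarged lcm divides `x^a`, so it cannot precede `q`.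
  · refine hp.not_ge (hq.2 (hle.trans ((lcm_mono (Finset.filter_subset _ _)).trans ?_)))
    exact (lcm_insert _ _).trans_le (sup_le hq.1 hAa)
  · rcases (hqA i hiA).eq_or_lt with rfl | hqi
    · refine hp.not_ge (hq.2 (hle.trans ((lcm_mono (Finset.filter_subset _ _)).trans ?_)))
      exact (lcm_insert _ _).trans_le (sup_le hq.1 hAa)
    · rw [Finset.filter_insert, if_neg hqi.not_ge] at hle
      refine hA i hiA ⟨j, ?_, hij⟩ p hp hle
      exact (Finset.mem_insert.1 hjA).resolve_left (hqi.trans hij).ne'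

end Combinatorics

/-! ### Exactness of the Lyubeznik complex, one multidegree at a time -/

section Exactness

variable {n : ℕ} {ι : Type v} [LinearOrder ι] {m : ι → (Fin n →₀ ℕ)} {K : Type u} [Field K]

variable (K) in
/-- The sign of the face of `A` opposite to `i`. -/
def sign (A : Finset ι) (i : ι) : K := (-1) ^ (A.filter (fun k => k < i)).card

theorem sign_insert_of_lt {A : Finset ι} {i q : ι} (hq : q ∉ A) (h : q < i) :
    sign K (insert q A) i = - sign K A i := by
  rw [sign, Finset.filter_insert, if_pos h, Finset.card_insert_of_notMem
    (fun hmem => hq (Finset.mem_filter.1 hmem).1), pow_succ, mul_neg_one, sign]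

theorem sign_insert_of_not_lt {A : Finset ι} {i q : ι} (h : ¬ q < i) :
    sign K (insert q A) i = sign K A i := by
  rw [sign, Finset.filter_insert, if_neg h, sign]

theorem sign_eq_one {A : Finset ι} {q : ι} (h : ∀ i ∈ A, q ≤ i) : sign K A q = 1 := by
  rw [sign, Finset.filter_false_of_mem fun i hi => (h i hi).not_gt, Finset.card_empty, pow_zero]

/-- Removing the smaller `i` shifts the position of `j` by one, while removing `j` leaves the
position of `i` alone. -/
theorem sign_mul_sign_of_lt {A : Finset ι} {i j : ι} (hi : i ∈ A) (hj : j ∈ A) (h : i < j) :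
    sign K A i * sign K (A.erase i) j + sign K A j * sign K (A.erase j) i = 0 := by
  have h₁ : sign K A j = - sign K (A.erase i) j := by
    conv_lhs => rw [← Finset.insert_erase hi]
    exact sign_insert_of_lt (Finset.notMem_erase i A) h
  have h₂ : sign K A i = sign K (A.erase j) i := by
    conv_lhs => rw [← Finset.insert_erase hj]
    exact sign_insert_of_not_lt h.not_gt
  rw [h₁, h₂]
  ring

theorem sign_mul_sign {A : Finset ι} {i j : ι} (hi : i ∈ A) (hj : j ∈ A) (h : i ≠ j) :
    sign K A i * sign K (A.erase i) j + sign K A j * sign K (A.erase j) i = 0 := by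
  rcases h.lt_or_gt with h | h
  · exact sign_mul_sign_of_lt hi hj h
  · rw [add_comm]
    exact sign_mul_sign_of_lt hj hi h

variable (m K) in
open Classical in
/-- The element of multidegree `a` of `L^t` lying over the symbol `A`, and `0` if `A` is not an
admissible symbol of dimension `t`. -/
noncomputable def cell (t : ℕ) (a : Fin n →₀ ℕ) (A : Finset ι) : Chain m K t :=
  if h : IsAdmissible m A ∧ A.card = t then
    Finsupp.single ⟨A, h⟩ (monomial (a - lcm m A) (1 : K)) else 0

theorem cell_of {t : ℕ} {a : Fin n →₀ ℕ} (A : Sym m t) :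
    cell m K t a A.1 = Finsupp.single A (monomial (a - lcm m A.1) (1 : K)) :=
  dif_pos A.2

theorem cell_of_card_ne {t : ℕ} {a : Fin n →₀ ℕ} {A : Finset ι} (h : A.card ≠ t) :
    cell m K t a A = 0 := dif_neg fun h' => h h'.2

/-- Monomial multiples of symbols form a `K`-basis; the multiple `x^b u(A)` is the cell of
multidegree `b + lcm m A`. -/
theorem chain_hom_ext {t : ℕ} {M : Type*} [AddCommMonoid M] [Module K M]
    {f g : Chain m K t →ₗ[K] M}
    (h : ∀ a (A : Sym m t), lcm m A.1 ≤ a → f (cell m K t a A.1) = g (cell m K t a A.1)) :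
    f = g := by
  refine Finsupp.lhom_ext' fun A => (basisMonomials (Fin n) K).ext fun b => ?_
  have := h (b + lcm m A.1) A le_add_self
  rw [cell_of, add_tsub_cancel_right] at this
  simpa using this

/-- Within one multidegree the monomial coefficients are absorbed by the cells, leaving the signed
simplicial boundary. -/
theorem diff_cell {t : ℕ} {a : Fin n →₀ ℕ} (A : Sym m (t + 1)) (hA : lcm m A.1 ≤ a) :
    diff m K t (cell m K (t + 1) a A.1) =
      ∑ i ∈ A.1, sign K A.1 i • cell m K t a (A.1.erase i) := by
  rw [cell_of, diff, Finsupp.linearCombination_single, Finset.smul_sum,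
    ← Finset.sum_attach A.1 fun i => sign K A.1 i • cell m K t a (A.1.erase i)]
  refine Finset.sum_congr rfl fun i _ => ?_
  have hle : lcm m (A.1.erase i.1) ≤ lcm m A.1 := lcm_mono (Finset.erase_subset _ _)
  have hc := cell_of (K := K) (a := a) (A.face i)
  rw [show (A.face i).1 = A.1.erase i.1 from rfl] at hc
  rw [hc, Finsupp.smul_single, Finsupp.smul_single, smul_eq_mul, mul_left_comm, monomial_mul,
    one_mul, tsub_add_tsub_cancel hA hle, sign, Algebra.smul_def, map_pow, map_neg,
    map_one (algebraMap K (MvPolynomial (Fin n) K))]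

theorem diff_diff_cell {t : ℕ} {a : Fin n →₀ ℕ} (A : Sym m (t + 2)) (hA : lcm m A.1 ≤ a) :
    diff m K t (diff m K (t + 1) (cell m K (t + 2) a A.1)) = 0 := by
  have key : ∀ i ∈ A.1, diff m K t (sign K A.1 i • cell m K (t + 1) a (A.1.erase i)) =
      ∑ j ∈ A.1.erase i, (sign K A.1 i * sign K (A.1.erase i) j) •
        cell m K t a ((A.1.erase i).erase j) := by
    intro i hi
    have h := diff_cell (K := K) (A.face ⟨i, hi⟩)
      ((lcm_mono (Finset.erase_subset _ _)).trans hA)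
    refine (LinearMap.map_smul_of_tower _ _ _).trans ((congrArg _ h).trans ?_)
    rw [Finset.smul_sum]
    exact Finset.sum_congr rfl fun j _ => smul_smul _ _ _
  rw [diff_cell A hA, map_sum, Finset.sum_congr rfl key, Finset.sum_sigma']
  -- The terms removing `i` then `j` and `j` then `i` cancel.
  refine Finset.sum_involution (fun p _ => ⟨p.2, p.1⟩) ?_ ?_ ?_ ?_
  · rintro ⟨i, j⟩ hp
    obtain ⟨hi, hj⟩ := Finset.mem_sigma.1 hp
    obtain ⟨hji, hj⟩ := Finset.mem_erase.1 hj
    dsimp only at hi hj hji ⊢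
    rw [Finset.erase_right_comm, ← add_smul, sign_mul_sign hi hj hji.symm, zero_smul]
  · rintro ⟨i, j⟩ hp - heq
    exact (Finset.mem_erase.1 (Finset.mem_sigma.1 hp).2).1 (congrArg Sigma.fst heq)
  · rintro ⟨i, j⟩ hp
    obtain ⟨hi, hj⟩ := Finset.mem_sigma.1 hp
    obtain ⟨hji, hj⟩ := Finset.mem_erase.1 hj
    exact Finset.mem_sigma.2 ⟨hj, Finset.mem_erase.2 ⟨hji.symm, hi⟩⟩
  · rintro ⟨i, j⟩ _
    rfl

theorem diff_diff (t : ℕ) (x : Chain m K (t + 2)) : diff m K t (diff m K (t + 1) x) = 0 := by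
  have : ((diff m K t).comp (diff m K (t + 1))).restrictScalars K = 0 :=
    chain_hom_ext fun a A hA => diff_diff_cell A hA
  exact LinearMap.congr_fun this x

variable (m K) in
open Classical in
/-- The element of multidegree `a` of `L^t` obtained by adding to the symbol `A` the least generator
that divides `x^a`. -/
noncomputable def coneCell (t : ℕ) (a : Fin n →₀ ℕ) (A : Finset ι) : Chain m K t :=
  -- For finite `ι`, the value `0` occurs only where no generator divides `x^a`; no nonempty symbol
  -- has a cell of interest there.
  if h : ∃ q, IsLeast {i | m i ≤ a} q then cell m K t a (insert h.choose A) else 0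

theorem coneCell_of {t : ℕ} {a : Fin n →₀ ℕ} {q : ι} (hq : IsLeast {i | m i ≤ a} q)
    (A : Finset ι) : coneCell m K t a A = cell m K t a (insert q A) := by
  have hex : ∃ q, IsLeast {i | m i ≤ a} q := ⟨q, hq⟩
  rw [coneCell, dif_pos hex, hex.choose_spec.unique hq]

variable (m K) in
/-- The contracting homotopy: in multidegree `a`, add the least generator dividing `x^a` to the
symbol. -/
noncomputable def homotopy (t : ℕ) : Chain m K t →ₗ[K] Chain m K (t + 1) :=
  Finsupp.lsum K fun A => (basisMonomials (Fin n) K).constr K fun b =>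
    coneCell m K (t + 1) (b + lcm m A.1) A.1

theorem homotopy_cell {t : ℕ} {a : Fin n →₀ ℕ} (A : Sym m t) (hA : lcm m A.1 ≤ a) {q : ι}
    (hq : IsLeast {i | m i ≤ a} q) :
    homotopy m K t (cell m K t a A.1) = cell m K (t + 1) a (insert q A.1) := by
  have hb := (basisMonomials (Fin n) K).constr_basis K
    (fun b => coneCell m K (t + 1) (b + lcm m A.1) A.1) (a - lcm m A.1)
  rw [tsub_add_cancel_of_le hA, coe_basisMonomials, coneCell_of hq] at hb
  rw [cell_of, homotopy, Finsupp.lsum_single]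
  exact hb

/-- Simplicial cone with apex `q`, which precedes all of `A` and so has sign `1`. If `q ∈ A`,
inserting it gives a set of the wrong cardinality, hence the zero cell, and only the face opposite
`q` contributes. If `q ∉ A`, the face of the cone opposite `q` is `A`, and the other faces cancel
against the cone over the boundary. -/
theorem diff_homotopy_cell {t : ℕ} {a : Fin n →₀ ℕ} (A : Sym m (t + 1)) (hA : lcm m A.1 ≤ a)
    {q : ι} (hq : IsLeast {i | m i ≤ a} q) :
    diff m K (t + 1) (homotopy m K (t + 1) (cell m K (t + 1) a A.1)) +
      homotopy m K t (diff m K t (cell m K (t + 1) a A.1)) = cell m K (t + 1) a A.1 := by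
  have hqA : ∀ i ∈ A.1, q ≤ i := fun i hi => hq.2 ((le_lcm hi).trans hA)
  have hsum : homotopy m K t (diff m K t (cell m K (t + 1) a A.1)) =
      ∑ i ∈ A.1, sign K A.1 i • cell m K (t + 1) a (insert q (A.1.erase i)) := by
    rw [diff_cell A hA, map_sum]
    refine Finset.sum_congr rfl fun i hi => ?_
    rw [map_smul]
    exact congrArg _ (homotopy_cell (A.face ⟨i, hi⟩)
      ((lcm_mono (Finset.erase_subset _ _)).trans hA) hq)
  rw [hsum, homotopy_cell A hA hq]
  by_cases hmem : q ∈ A.1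
  · rw [Finset.insert_eq_of_mem hmem, cell_of_card_ne (by rw [A.2.2]; omega), map_zero, zero_add,
      Finset.sum_eq_single_of_mem q hmem, sign_eq_one hqA, one_smul, Finset.insert_erase hmem]
    intro i hi hiq
    rw [Finset.insert_eq_of_mem (Finset.mem_erase.2 ⟨hiq.symm, hmem⟩), cell_of_card_ne, smul_zero]
    rw [Finset.card_erase_of_mem hi, A.2.2]
    omega
  · have hcard : (insert q A.1).card = t + 2 := by
      rw [Finset.card_insert_of_notMem hmem, A.2.2]
    rw [diff_cell ⟨insert q A.1, A.2.1.insert hA hq, hcard⟩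
      ((lcm_insert _ _).trans_le (sup_le hq.1 hA)), Finset.sum_insert hmem,
      sign_insert_of_not_lt (lt_irrefl q), sign_eq_one hqA, one_smul, Finset.erase_insert hmem,
      add_assoc, ← Finset.sum_add_distrib, Finset.sum_eq_zero, add_zero]
    intro i hi
    have hne : q ≠ i := fun h => hmem (h ▸ hi)
    rw [sign_insert_of_lt hmem ((hqA i hi).lt_of_ne hne), Finset.erase_insert_of_ne hne, neg_smul,
      neg_add_cancel]

theorem exists_isLeast_of_le [Finite ι] {a : Fin n →₀ ℕ} {i : ι} (hi : m i ≤ a) :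
    ∃ q, IsLeast {i | m i ≤ a} q :=
  have hfin := Set.toFinite {i | m i ≤ a}
  ⟨hfin.toFinset.min' ⟨i, by simpa using hi⟩, by simpa using hfin.toFinset.isLeast_min' _⟩

theorem diff_homotopy [Finite ι] (t : ℕ) (x : Chain m K (t + 1)) :
    diff m K (t + 1) (homotopy m K (t + 1) x) + homotopy m K t (diff m K t x) = x := by
  have : (diff m K (t + 1)).restrictScalars K ∘ₗ homotopy m K (t + 1) +
      homotopy m K t ∘ₗ (diff m K t).restrictScalars K = LinearMap.id := by
    refine chain_hom_ext fun a A hA => ?_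
    obtain ⟨i, hi⟩ : A.1.Nonempty := Finset.card_pos.1 (by rw [A.2.2]; omega)
    obtain ⟨q, hq⟩ := exists_isLeast_of_le ((le_lcm hi).trans hA)
    exact diff_homotopy_cell A hA hq
  exact LinearMap.congr_fun this x

theorem exact_diff [Finite ι] (t : ℕ) : Function.Exact (diff m K (t + 1)) (diff m K t) := by
  refine fun x => ⟨fun hx => ⟨homotopy m K (t + 1) x, ?_⟩, ?_⟩
  · simpa [hx] using diff_homotopy t x
  · rintro ⟨y, rfl⟩
    exact diff_diff t y

theorem isAdmissible_empty : IsAdmissible m ∅ := fun i hi => absurd hi (Finset.notMem_empty i)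

variable (m) in
/-- The empty symbol. -/
def emptySym : Sym m 0 := ⟨∅, isAdmissible_empty, rfl⟩

theorem eq_emptySym (A : Sym m 0) : A = emptySym m := Subtype.ext (Finset.card_eq_zero.1 A.2.2)

theorem cell_zero (a : Fin n →₀ ℕ) :
    cell m K 0 a ∅ = Finsupp.single (emptySym m) (monomial a (1 : K)) := by
  refine (cell_of (emptySym m)).trans ?_
  rw [show lcm m (emptySym m).1 = 0 from rfl, tsub_zero]

theorem diff_cell_singleton {a : Fin n →₀ ℕ} {i : ι} (A : Sym m 1) (hA : A.1 = {i})
    (hi : m i ≤ a) : diff m K 0 (cell m K 1 a A.1) = cell m K 0 a ∅ := by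
  rw [diff_cell A (by rw [hA, lcm, Finset.sup_singleton]; exact hi), hA, Finset.sum_singleton,
    sign_eq_one fun j hj => (Finset.mem_singleton.1 hj).ge, one_smul]
  congr 1
  exact Finset.erase_singleton i

theorem isAdmissible_singleton (i : ι) : IsAdmissible m {i} := by
  rintro j hj ⟨k, hk, hlt⟩
  rw [Finset.mem_singleton] at hj hk
  exact absurd (hj.trans hk.symm) hlt.ne

theorem augmentation_apply (I : Ideal (MvPolynomial (Fin n) K)) (x : Chain m K 0) :
    augmentation m K I x = Ideal.Quotient.mk I (x (emptySym m)) := by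
  have hx : x = Finsupp.single (emptySym m) (x (emptySym m)) := by
    ext1 A
    rw [eq_emptySym A, Finsupp.single_eq_same]
  conv_lhs => rw [hx]
  rw [augmentation, Finsupp.linearCombination_single, ← Ideal.Quotient.mk_eq_mk,
    ← Submodule.Quotient.mk_smul, smul_eq_mul, mul_one, Ideal.Quotient.mk_eq_mk]

theorem exact_augmentation {I : Ideal (MvPolynomial (Fin n) K)}
    (hI : I = Ideal.span ((fun a => monomial a (1 : K)) '' Set.range m)) :
    Function.Exact (diff m K 0) (augmentation m K I) := by
  intro x
  rw [augmentation_apply, Ideal.Quotient.eq_zero_iff_mem]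
  constructor
  · intro hx
    rw [hI, mem_ideal_span_monomial_image] at hx
    have hsum : x = ∑ b ∈ (x (emptySym m)).support,
        (x (emptySym m)).coeff b • cell m K 0 b ∅ := by
      ext1 A
      rw [eq_emptySym A, Finsupp.finsetSum_apply]
      conv_lhs => rw [(x (emptySym m)).as_sum]
      refine Finset.sum_congr rfl fun b _ => ?_
      rw [cell_zero, Finsupp.smul_apply, Finsupp.single_eq_same, smul_monomial, smul_eq_mul,
        mul_one]
    -- Each monomial of an element of a monomial ideal is divisible by a generator `m i`, hence is
    -- the boundary of a cell on `{i}`.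
    change x ∈ LinearMap.range ((diff m K 0).restrictScalars K)
    rw [hsum]
    refine Submodule.sum_mem _ fun b hb => Submodule.smul_mem _ _ ?_
    obtain ⟨_, ⟨i, rfl⟩, hi⟩ := hx b hb
    exact ⟨_, diff_cell_singleton ⟨{i}, isAdmissible_singleton i, rfl⟩ rfl hi⟩
  · rintro ⟨y, rfl⟩
    rw [← Ideal.Quotient.eq_zero_iff_mem, ← augmentation_apply]
    have : ((augmentation m K I).restrictScalars K) ∘ₗ (diff m K 0).restrictScalars K = 0 := by
      refine chain_hom_ext fun a A hA => ?_
      obtain ⟨i, hi⟩ := Finset.card_eq_one.1 A.2.2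
      have hia : m i ≤ a := (le_lcm (hi ▸ Finset.mem_singleton_self i)).trans hA
      change augmentation m K I (diff m K 0 (cell m K 1 a A.1)) = 0
      rw [diff_cell_singleton A hi hia, cell_zero, augmentation_apply, Finsupp.single_eq_same,
        Ideal.Quotient.eq_zero_iff_mem, hI, mem_ideal_span_monomial_image]
      intro b hb
      rw [Finset.mem_singleton.1 (support_monomial_subset hb)]
      exact ⟨m i, ⟨i, rfl⟩, hia⟩
    exact LinearMap.congr_fun this y

/-- Lyubeznik's theorem: for every total order on a finite set of monomial generators, the
Lyubeznik complex is a free resolution. -/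
theorem isResolution [Finite ι] {I : Ideal (MvPolynomial (Fin n) K)}
    (hI : I = Ideal.span ((fun a => monomial a (1 : K)) '' Set.range m)) :
    IsResolution m K I := by
  refine ⟨fun y => ?_, exact_augmentation hI, exact_diff⟩
  obtain ⟨p, rfl⟩ := Ideal.Quotient.mk_surjective y
  exact ⟨Finsupp.single (emptySym m) p, by rw [augmentation_apply, Finsupp.single_eq_same]⟩

end Exactness

/-! ### Minimal generators and bounds on the projective dimension -/

section ProjectiveDimension

variable {K : Type u} [Field K] {n : ℕ} (I : Ideal (MvPolynomial (Fin n) K))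

theorem G.eq_of_mon_le (g g' : G I) (h : G.mon I g ≤ G.mon I g') : g = g' :=
  Subtype.ext (le_antisymm h (g'.2.2 g.2.1 h))

/-- Dickson's lemma: exponent vectors are well-quasi-ordered, so the antichain of minimal elements
is finite. -/
instance : Finite (G I) := by
  refine (WellQuasiOrderedLE.finite_of_isAntichain
    (s := {a : Fin n →₀ ℕ | Minimal (fun b => monomial b (1 : K) ∈ I) a}) ?_).to_subtype
  exact setOfPred_minimal_antichain _

variable {I} in
theorem IsMonomialIdeal.eq_span (hI : IsMonomialIdeal I) :
    I = Ideal.span ((fun a => monomial a (1 : K)) '' Set.range (G.mon I)) := by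
  refine le_antisymm ?_ (Ideal.span_le.2 ?_)
  · obtain ⟨S, hS⟩ := hI
    nth_rw 1 [hS]
    refine Ideal.span_le.2 ?_
    rintro _ ⟨a, ha, rfl⟩
    have haI : monomial a (1 : K) ∈ I := hS ▸ Ideal.subset_span ⟨a, ha, rfl⟩
    obtain ⟨b, hba, hb⟩ := exists_minimal_le_of_wellFoundedLT
      (fun b => monomial b (1 : K) ∈ I) a haI
    rw [SetLike.mem_coe, mem_ideal_span_monomial_image]
    intro c hc
    rw [Finset.mem_singleton.1 (support_monomial_subset hc)]
    exact ⟨b, ⟨⟨b, hb⟩, rfl⟩, hba⟩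
  · rintro _ ⟨_, ⟨g, rfl⟩, rfl⟩
    exact g.2.1

theorem LLength_eq_ps : LLength I = ps I := by
  have h : ∀ ord : LinearOrder (G I), orderedLLength I ord = orderedPs I ord := fun ord =>
    length_eq_preservedSize K (G.eq_of_mon_le I)
  simp only [LLength, ps, h]

open Classical in
theorem exists_orderedLLength_eq : ∃ ord : LinearOrder (G I), orderedLLength I ord = LLength I :=
  Nat.sInf_mem (s := {k | ∃ ord : LinearOrder (G I), orderedLLength I ord = k})
    -- `sInf` in `ℕ` is attained only on a nonempty set, so some total order has to be exhibited.
    ⟨_, linearOrderOfSTO (WellOrderingRel : G I → G I → Prop), rfl⟩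

theorem LLength_le (ord : LinearOrder (G I)) : LLength I ≤ orderedLLength I ord :=
  Nat.sInf_le ⟨ord, rfl⟩

variable {I}

theorem IsMonomialIdeal.projdim_le (hI : IsMonomialIdeal I) :
    projdim I ≤ (LLength I : WithBot ℕ∞) := by
  obtain ⟨ord, hord⟩ := exists_orderedLLength_eq I
  obtain ⟨h₁, h₂, h₃⟩ := isResolution hI.eq_span
  have := subsingleton_chain_length_succ (G.mon I) K
  rw [← hord, projdim, projectiveDimension_le_iff]
  exact hasProjectiveDimensionLT_of_resolution (length (G.mon I) K) (Chain (G.mon I) K)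
    (diff (G.mon I) K) (augmentation (G.mon I) K I) h₁ h₂ h₃

theorem span_range_X_ne_top :
    Ideal.span (Set.range (X : Fin n → MvPolynomial (Fin n) K)) ≠ ⊤ := by
  rw [Ideal.ne_top_iff_one, ← Set.image_univ, mem_ideal_span_X_image]
  intro h
  obtain ⟨i, -, hi⟩ := h 0 (by simp)
  exact hi rfl

theorem IsLyubeznikIdeal.le_projdim (hI : IsLyubeznikIdeal I) :
    (LLength I : WithBot ℕ∞) ≤ projdim I := by
  obtain ⟨ord, ⟨h₁, h₂, h₃⟩, hmin⟩ := hI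
  have := subsingleton_chain_length_succ (G.mon I) K
  have := nontrivial_chain_length (G.mon I) K
  -- The order giving a minimal resolution is not assumed to minimise the length; `L(I) ≤ L_≺(I)`
  -- suffices.
  refine le_trans (Nat.mono_cast (LLength_le I ord)) ?_
  rw [projdim, projectiveDimension_ge_iff]
  exact not_hasProjectiveDimensionLT_of_minimal (length (G.mon I) K) span_range_X_ne_top
    (Chain (G.mon I) K) (diff (G.mon I) K) (augmentation (G.mon I) K I) h₁ h₂ h₃ hmin

end ProjectiveDimension

end Lyubeznik

theorem mainTheorem8 {K : Type*} [Field K] {n : ℕ} (I : Ideal (MvPolynomial (Fin n) K))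
    (hI : Lyubeznik.IsMonomialIdeal I) :
    ((Lyubeznik.IsLyubeznikIdeal I ∨ Lyubeznik.IsAlmostLyubeznikIdeal I) →
      Lyubeznik.projdim I = (Lyubeznik.LLength I : WithBot ℕ∞) ∧
        Lyubeznik.LLength I = Lyubeznik.ps I) ∧
    (Lyubeznik.projdim I = (Lyubeznik.ps I : WithBot ℕ∞) →
      Lyubeznik.IsAlmostLyubeznikIdeal I) := by
  refine ⟨fun h => ⟨?_, Lyubeznik.LLength_eq_ps I⟩, fun h => ?_⟩
  · rcases h with h | h
    · exact le_antisymm hI.projdim_le h.le_projdim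
    · exact h.symm
  · rw [Lyubeznik.IsAlmostLyubeznikIdeal, Lyubeznik.LLength_eq_ps, h]
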